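/- Notation. $|\cdot|$ is the Euclidean norm. A lower index denotes a fibre with that variable (or those variables) held fixed, e.g. $f_x(y,z)=f(x,y,z)$ and $f_{x,y}(z)=f(x,y,z)$; primes denote derivatives in the remaining variable. For $W\subset\mathbb R^d$ closed and bounded, a function $g:\mathbb R^d\setminus W\to\mathbb R$ is of *decrease $n$* if there is $C>0$ with $|g(p)|\le C/|p|^n$ for all $p\in\mathbb R^d\setminus W$ with $|p|>1$. Dimension 1. With $W\subset\mathbb R$ closed and bounded, a smooth $g:\mathbb R\setminus W\to\mathbb R$ is *analytic at infinity* if there are $\epsilon_1,\epsilon_2>0$ and real sequences $(a_n)_{n\ge1},(b_n)_{n\ge 1}$ such that $g(1/x)=\sum_{n\ge1}a_nx^n$ for $0<x<\epsilon_1$ and $g(1/x)=\sum_{n\ge1}b_nx^n$ for $-\epsilon_2<x<0$, both series being absolutely convergent. Dimension 2. Let $W\subset\mathbb R^2$ be closed and bounded and $g:\mathbb R^2\setminus W\to\mathbb R$ smooth. Consider the conditions: (i) $g_x$ is analytic at infinity for every $x\in\mathbb R$; (ii) $g_y$ is analytic at infinity for every $y\in\mathbb R$; (iii) $g$ is of decrease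 $1$; (iv) $\partial g/\partial x$ and $\partial g/\partial y$ are of decrease $2$. The function $g$ is *quasi normal* if (i)–(iv) hold and there are constants $K,L$ such that for $|x|>K$ the zeros of each of $g_x,(g_x)',(g_x)''$ are contained in a set $(-M,-N)\cup(N,M)$ with $M,N\in\mathbb R$, $M-N\le L$ ($M,N$ may depend on $x$ and on which of the three functions is considered), and likewise for $g_y,(g_y)',(g_y)''$ when $|y|>K$. It is *quasi split normal* if (i)–(iv) hold and, for all sufficiently large $(x,y)$, $g=g_1+g_2$, where $g_1,g_2$ are quasi normal (each one defined and smooth off some closed bounded set). Dimension 3. Let $f:\mathbb R^3\to\mathbb R$ be smooth. Consider the conditions: (iv) $f$ is of decrease $1$; (v) for all $i,j,k\ge 0$ with $i+j+k\ge1$, $\partial^{i+j+k}f/\partial x^i\partial y^j\partial z^k$ is of decrease $i+j+k+1$. A function $g(x,y,z)$, defined at least for all large $(x,y)$ and all $z$, has *zeros in intervals with respect to $(x,y)$* if there are $K,R\in\mathbb R$ and $S\in\mathbb N$ such that for every $(x,y)$ with $|(x,y)|>K$ the zeros of each of $g_{x,y},(g_{x,y})',(g_{x,y})'',(g_{x,y})''',(g_{x,y})''''$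 are contained in a union of $S$ bounded intervals of total length at most $R$; similarly for $(x,z)$ and $(y,z)$. The function $f$ is *quasi normal* if all its fibres $f_x,f_y,f_z$ (for all $x,y,z\in\mathbb R$) are quasi normal functions on $\mathbb R^2$, (iv) and (v) hold, and $f$ has zeros in intervals with respect to $(x,y)$, to $(x,z)$ and to $(y,z)$. It is *quasi split normal* if all its fibres $f_x,f_y,f_z$ are quasi split normal functions on $\mathbb R^2$, (iv) and (v) hold, and, for all sufficiently large $(x,y)$ and all $z$, $f=f_1+f_2$ with $f_1,f_2$ smooth there and having zeros in intervals with respect to $(x,y)$; and similarly for $(x,z)$ and for $(y,z)$. Statement. Let $f:\mathbb R^3\to\mathbb R$ be smooth and either quasi normal or quasi split normal. Then for all $x,y,z\in\mathbb R$ and all nonzero real $k_1,k_2,k_3$ the limits $$A(k_1,y,z)=\lim_{r\to\infty}\int_{-r}^{r}f(x,y,z)e^{-ik_1x}\,dx,\quad B(x,k_2,z)=\lim_{r\to\infty}\int_{-r}^{r}f(x,y,z)e^{-ik_2y}\,dy,\quad C(x,y,k_3)=\lim_{r\to\infty}\int_{-r}^{r}f(x,y,z)e^{-ik_3z}\,dz,$$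 $$F(k_1,k_2,z)=\lim_{r,s\to\infty}\int_{-r}^{r}\int_{-s}^{s}f(x,y,z)e^{-ik_1x}e^{-ik_2y}\,dx\,dy,$$ $$G(k_1,y,k_3)=\lim_{r,s\to\infty}\int_{-r}^{r}\int_{-s}^{s}f(x,y,z)e^{-ik_1x}e^{-ik_3z}\,dx\,dz,$$ $$H(x,k_2,k_3)=\lim_{r,s\to\infty}\int_{-r}^{r}\int_{-s}^{s}f(x,y,z)e^{-ik_2y}e^{-ik_3z}\,dy\,dz$$ exist (with $r,s$ tending to infinity independently). For all nonzero $k_1,k_2,k_3$ the integrands in the following six integrals are Lebesgue integrable (over $\mathbb R^2$, respectively $\mathbb R$), so that one can define $$A(k_1,k_2,k_3)=\int_{-\infty}^{\infty}\int_{-\infty}^{\infty}A(k_1,y,z)e^{-ik_2y}e^{-ik_3z}\,dy\,dz,\qquad F(k_1,k_2,k_3)=\int_{-\infty}^{\infty}F(k_1,k_2,z)e^{-ik_3z}\,dz,$$ $$B(k_1,k_2,k_3)=\int_{-\infty}^{\infty}\int_{-\infty}^{\infty}B(x,k_2,z)e^{-ik_1x}e^{-ik_3z}\,dx\,dz,\qquad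 G(k_1,k_2,k_3)=\int_{-\infty}^{\infty}G(k_1,y,k_3)e^{-ik_2y}\,dy,$$ $$C(k_1,k_2,k_3)=\int_{-\infty}^{\infty}\int_{-\infty}^{\infty}C(x,y,k_3)e^{-ik_1x}e^{-ik_2y}\,dx\,dy,\qquad H(k_1,k_2,k_3)=\int_{-\infty}^{\infty}H(x,k_2,k_3)e^{-ik_1x}\,dx,$$ and all six agree and equal the limit of the integrals over boxes: $$A=B=C=F=G=H=\lim_{r\to\infty,\,s\to\infty,\,t\to\infty}\int_{-r}^{r}\int_{-s}^{s}\int_{-t}^{t}f(x,y,z)e^{-ik_1x}e^{-ik_2y}e^{-ik_3z}\,dx\,dy\,dz,$$ where $r,s,t$ tend to infinity independently. -/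

import Mathlib

open MeasureTheory Filter Topology Set
open scoped ContDiff

/-- `f : ℝ ∖ W → ℝ` (given by a total function whose values on `W` are irrelevant) is analytic at
infinity: `W` is closed and bounded, `f` is smooth off `W`, and `f (1/x)` is the sum of a convergent
power series without constant term for small `x > 0`, and of another one for small `x < 0`.
(In `ℝ`, `HasSum` is absolute convergence.  As `W` is bounded, `1/x ∉ W` for small `x`.) -/
structure IsAnalyticAtInfinity (W : Set ℝ) (f : ℝ → ℝ) : Prop where
  isClosed : IsClosed W
  isBounded : Bornology.IsBounded W
  smooth : ContDiffOn ℝ ∞ f Wᶜ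
  pos : ∃ ε > 0, ∃ a : ℕ → ℝ, ∀ x : ℝ, 0 < x → x < ε →
    HasSum (fun n : ℕ => a (n + 1) * x ^ (n + 1)) (f (1 / x))
  neg : ∃ ε > 0, ∃ b : ℕ → ℝ, ∀ x : ℝ, -ε < x → x < 0 →
    HasSum (fun n : ℕ => b (n + 1) * x ^ (n + 1)) (f (1 / x))

/-! ### Functions on the plane -/

/-- `|f(x,y)| ≤ C / |(x,y)|^n` on the part of `ℝ² ∖ W` with `|(x,y)| > 1`
(`n = 1`: very moderate decrease, `n = 2`: moderate decrease). -/
def IsOfDecrease₂ (n : ℕ) (W : Set (ℝ × ℝ)) (f : ℝ → ℝ → ℝ) : Prop :=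
  ∃ C > 0, ∀ x y : ℝ, (x, y) ∉ W → 1 < √(x ^ 2 + y ^ 2) → |f x y| ≤ C / √(x ^ 2 + y ^ 2) ^ n

/-- For all `x` with `|x|` large, the zeros of `f_x`, of `(f_x)'` and of `(f_x)''` lie (for each of
the three functions) in a set `(-M, -N) ∪ (N, M)` with `M - N` bounded uniformly in `x`.
(If `f` is only given off a bounded set, `f_x` is everywhere defined for `|x|` large.) -/
def HasZerosInSymmetricIntervals (f : ℝ → ℝ → ℝ) : Prop :=
  ∃ K L : ℝ, ∀ x : ℝ, K < |x| → ∀ j : ℕ, j ≤ 2 → ∃ M N : ℝ, M - N ≤ L ∧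
    ∀ y : ℝ, iteratedDeriv j (f x) y = 0 → y ∈ Ioo (-M) (-N) ∪ Ioo N M

/-- The conditions shared by quasi normal and quasi split normal functions on `ℝ² ∖ W`. -/
structure IsPreNormal₂ (W : Set (ℝ × ℝ)) (f : ℝ → ℝ → ℝ) : Prop where
  isClosed : IsClosed W
  isBounded : Bornology.IsBounded W
  smooth : ContDiffOn ℝ ∞ (fun p : ℝ × ℝ => f p.1 p.2) Wᶜ
  fibre_x : ∀ x : ℝ, IsAnalyticAtInfinity {y | (x, y) ∈ W} (fun y => f x y)
  fibre_y : ∀ y : ℝ, IsAnalyticAtInfinity {x | (x, y) ∈ W} (fun x => f x y)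
  decrease : IsOfDecrease₂ 1 W f
  decrease_dx : IsOfDecrease₂ 2 W (fun x y => deriv (fun x' => f x' y) x)
  decrease_dy : IsOfDecrease₂ 2 W (fun x y => deriv (fun y' => f x y') y)

/-- Quasi normal functions `f : ℝ² ∖ W → ℝ`. -/
structure IsQuasiNormal₂ (W : Set (ℝ × ℝ)) (f : ℝ → ℝ → ℝ) : Prop where
  preNormal : IsPreNormal₂ W f
  zeros_x : HasZerosInSymmetricIntervals (fun x y => f x y)
  zeros_y : HasZerosInSymmetricIntervals (fun y x => f x y)

/-- Quasi split normal functions `f : ℝ² ∖ W → ℝ`: near infinity `f` is the sum of two quasi normal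
functions, each of them defined and smooth off some closed bounded set. -/
structure IsQuasiSplitNormal₂ (W : Set (ℝ × ℝ)) (f : ℝ → ℝ → ℝ) : Prop where
  preNormal : IsPreNormal₂ W f
  split : ∃ (W₁ W₂ : Set (ℝ × ℝ)) (f₁ f₂ : ℝ → ℝ → ℝ) (K : ℝ),
    IsQuasiNormal₂ W₁ f₁ ∧ IsQuasiNormal₂ W₂ f₂ ∧
      ∀ x y : ℝ, K < √(x ^ 2 + y ^ 2) → f x y = f₁ x y + f₂ x y

/-! ### Functions on space -/

/-- `|f(x,y,z)| ≤ C / |(x,y,z)|^n` on the part of `ℝ³ ∖ W` with `|(x,y,z)| > 1`. -/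
def IsOfDecrease₃ (n : ℕ) (W : Set (ℝ × ℝ × ℝ)) (f : ℝ → ℝ → ℝ → ℝ) : Prop :=
  ∃ C > 0, ∀ x y z : ℝ, (x, y, z) ∉ W → 1 < √(x ^ 2 + y ^ 2 + z ^ 2) →
    |f x y z| ≤ C / √(x ^ 2 + y ^ 2 + z ^ 2) ^ n

/-- The partial derivative `∂^{i+j+k} f / ∂x^i ∂y^j ∂z^k`. -/
noncomputable def partialDeriv₃ (i j k : ℕ) (f : ℝ → ℝ → ℝ → ℝ) (x y z : ℝ) : ℝ :=
  iteratedDeriv i (fun x' => iteratedDeriv j (fun y' => iteratedDeriv k (fun z' => f x' y' z') z) y) x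

/-- For all `(u,v)` with `|(u,v)|` large, the zeros of `f_{u,v}` and of its first four derivatives
are contained in a union of `S` intervals of total length at most `R`, with `S` and `R` independent
of `(u,v)`. -/
def HasZerosInIntervals (f : ℝ → ℝ → ℝ → ℝ) : Prop :=
  ∃ (K R : ℝ) (S : ℕ), ∀ u v : ℝ, K < √(u ^ 2 + v ^ 2) → ∀ j : ℕ, j ≤ 4 →
    ∃ a b : Fin S → ℝ, (∀ i, a i ≤ b i) ∧ ∑ i, (b i - a i) ≤ R ∧
      ∀ w : ℝ, iteratedDeriv j (f u v) w = 0 → ∃ i, w ∈ Icc (a i) (b i)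

/-- For all `(u,v)` with `|(u,v)|` large, `f = f₁ + f₂` with `f₁`, `f₂` smooth and such that
both have the property `HasZerosInIntervals`. -/
def HasSplitZerosInIntervals (f : ℝ → ℝ → ℝ → ℝ) : Prop :=
  ∃ (K : ℝ) (f₁ f₂ : ℝ → ℝ → ℝ → ℝ),
    ContDiffOn ℝ ∞ (fun p : ℝ × ℝ × ℝ => f₁ p.1 p.2.1 p.2.2) {p | K < √(p.1 ^ 2 + p.2.1 ^ 2)} ∧
    ContDiffOn ℝ ∞ (fun p : ℝ × ℝ × ℝ => f₂ p.1 p.2.1 p.2.2) {p | K < √(p.1 ^ 2 + p.2.1 ^ 2)} ∧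
    (∀ u v w : ℝ, K < √(u ^ 2 + v ^ 2) → f u v w = f₁ u v w + f₂ u v w) ∧
    HasZerosInIntervals f₁ ∧ HasZerosInIntervals f₂

/-- The conditions, other than those on fibres and zeros, shared by quasi normal and quasi split
normal functions on `ℝ³ ∖ W`. -/
structure IsPreNormal₃ (W : Set (ℝ × ℝ × ℝ)) (f : ℝ → ℝ → ℝ → ℝ) : Prop where
  isClosed : IsClosed W
  isBounded : Bornology.IsBounded W
  smooth : ContDiffOn ℝ ∞ (fun p : ℝ × ℝ × ℝ => f p.1 p.2.1 p.2.2) Wᶜ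
  decrease : IsOfDecrease₃ 1 W f
  decrease_partialDeriv : ∀ i j k : ℕ, 1 ≤ i + j + k →
    IsOfDecrease₃ (i + j + k + 1) W (partialDeriv₃ i j k f)

/-- Quasi normal functions `f : ℝ³ ∖ W → ℝ`. -/
structure IsQuasiNormal₃ (W : Set (ℝ × ℝ × ℝ)) (f : ℝ → ℝ → ℝ → ℝ) : Prop where
  preNormal : IsPreNormal₃ W f
  fibre_x : ∀ x : ℝ, IsQuasiNormal₂ {p | (x, p.1, p.2) ∈ W} (fun y z => f x y z)
  fibre_y : ∀ y : ℝ, IsQuasiNormal₂ {p | (p.1, y, p.2) ∈ W} (fun x z => f x y z)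
  fibre_z : ∀ z : ℝ, IsQuasiNormal₂ {p | (p.1, p.2, z) ∈ W} (fun x y => f x y z)
  zeros_xy : HasZerosInIntervals (fun x y z => f x y z)
  zeros_xz : HasZerosInIntervals (fun x z y => f x y z)
  zeros_yz : HasZerosInIntervals (fun y z x => f x y z)

/-- Quasi split normal functions `f : ℝ³ ∖ W → ℝ`. -/
structure IsQuasiSplitNormal₃ (W : Set (ℝ × ℝ × ℝ)) (f : ℝ → ℝ → ℝ → ℝ) : Prop where
  preNormal : IsPreNormal₃ W f
  fibre_x : ∀ x : ℝ, IsQuasiSplitNormal₂ {p | (x, p.1, p.2) ∈ W} (fun y z => f x y z)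
  fibre_y : ∀ y : ℝ, IsQuasiSplitNormal₂ {p | (p.1, y, p.2) ∈ W} (fun x z => f x y z)
  fibre_z : ∀ z : ℝ, IsQuasiSplitNormal₂ {p | (p.1, p.2, z) ∈ W} (fun x y => f x y z)
  zeros_xy : HasSplitZerosInIntervals (fun x y z => f x y z)
  zeros_xz : HasSplitZerosInIntervals (fun x z y => f x y z)
  zeros_yz : HasSplitZerosInIntervals (fun y z x => f x y z)

/-- The Fourier kernel `e^{-ikx}`. -/
noncomputable def fourierKernel (k x : ℝ) : ℂ := Complex.exp (-(Complex.I * k * x))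

/-!
A smooth function on `ℝ³` all of whose derivatives of order `j` are `O(|p|^{-1-j})` is a symbol of
order `-1`. Integrating by parts once in `x` bounds `∫_{-r}^{r} f e^{-ik₁x} dx` and its derivatives
in `(y, z)`: the derivative of `f` gains one power of `1 + |(y, z)|`, and integrating over `x` loses
it. The truncated transform is therefore a symbol of the same order in the remaining variables,
uniformly in `r`, and the step can be repeated in `y` and in `z`. For symbols of order `-1` on the
line the truncated transforms converge at a rate depending only on the symbol constant, so all the
limits may be taken jointly. As `r → ∞` the boundary terms disappear and further integrations by
parts gain decay, which makes the limit transforms integrable. The six iterated integrals are then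
limits of integrals over boxes, up to Fubini, and hence agree.
-/

section Symbol

variable {E F : Type*} [NormedAddCommGroup E] [NormedSpace ℝ E]
  [NormedAddCommGroup F] [NormedSpace ℝ F]

/-- The symbol class `S^{-m}` with `d` derivatives: `f` is of class `C^d`, and its derivatives of
order `j ≤ d` in directions from the unit ball are bounded by `C / (1 + ‖p‖)^(m + j)`. A single
constant `C` serves all orders, so that uniformity in a family of symbols can be expressed. -/
def IsSymbol (C : ℝ) : (d m : ℕ) → (f : E → ℂ) → Prop
  | 0, m, f => Continuous f ∧ ∀ p, ‖f p‖ ≤ C / (1 + ‖p‖) ^ m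
  | d + 1, m, f => ContDiff ℝ 1 f ∧ (∀ p, ‖f p‖ ≤ C / (1 + ‖p‖) ^ m) ∧
      ∀ v, ‖v‖ ≤ 1 → IsSymbol C d (m + 1) fun p => fderiv ℝ f p v

namespace IsSymbol

variable {C C' : ℝ} {d d' m m' : ℕ} {f g : E → ℂ}

lemma norm_le (hf : IsSymbol C d m f) (p : E) : ‖f p‖ ≤ C / (1 + ‖p‖) ^ m := by
  cases d with
  | zero => exact hf.2 p
  | succ d => exact hf.2.1 p

lemma continuous (hf : IsSymbol C d m f) : Continuous f := by
  cases d with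
  | zero => exact hf.1
  | succ d => exact hf.1.continuous

lemma contDiff (hf : IsSymbol C (d + 1) m f) : ContDiff ℝ 1 f := hf.1

lemma hasFDerivAt (hf : IsSymbol C (d + 1) m f) (p : E) : HasFDerivAt f (fderiv ℝ f p) p :=
  (hf.contDiff.differentiable one_ne_zero p).hasFDerivAt

lemma fderiv_apply (hf : IsSymbol C (d + 1) m f) {v : E} (hv : ‖v‖ ≤ 1) :
    IsSymbol C d (m + 1) fun p => fderiv ℝ f p v :=
  hf.2.2 v hv

lemma const_nonneg (hf : IsSymbol C d m f) : 0 ≤ C := by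
  simpa using (norm_nonneg (f 0)).trans (hf.norm_le 0)

lemma norm_le_const (hf : IsSymbol C d m f) (p : E) : ‖f p‖ ≤ C :=
  (hf.norm_le p).trans <| div_le_self hf.const_nonneg <|
    one_le_pow₀ <| le_add_of_nonneg_right <| norm_nonneg p

lemma norm_fderiv_le (hf : IsSymbol C (d + 1) m f) (p : E) : ‖fderiv ℝ f p‖ ≤ C :=
  ContinuousLinearMap.opNorm_le_of_unit_norm hf.const_nonneg fun _ hv =>
    (hf.fderiv_apply hv.le).norm_le_const p

lemma mono (hf : IsSymbol C d m f) (hC : C ≤ C') (hd : d' ≤ d) (hm : m' ≤ m) :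
    IsSymbol C' d' m' f := by
  have hbound {d m m' : ℕ} {f : E → ℂ} (hf : IsSymbol C d m f) (hm : m' ≤ m) (p : E) :
      ‖f p‖ ≤ C' / (1 + ‖p‖) ^ m' :=
    (hf.norm_le p).trans <| div_le_div₀ (hf.const_nonneg.trans hC) hC (by positivity) <|
      pow_le_pow_right₀ (le_add_of_nonneg_right <| norm_nonneg p) hm
  induction d' generalizing d m m' f with
  | zero => exact ⟨hf.continuous, hbound hf hm⟩
  | succ d' ih =>
    obtain ⟨d, rfl⟩ := Nat.exists_eq_add_of_le' hd
    exact ⟨hf.contDiff, hbound hf hm, fun _ hv =>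
      ih (hf.fderiv_apply hv) (Nat.le_add_left d' d) (Nat.succ_le_succ hm)⟩

lemma add (hf : IsSymbol C d m f) (hg : IsSymbol C' d m g) :
    IsSymbol (C + C') d m fun p => f p + g p := by
  have hbound {d m : ℕ} {f g : E → ℂ} (hf : IsSymbol C d m f) (hg : IsSymbol C' d m g) (p : E) :
      ‖f p + g p‖ ≤ (C + C') / (1 + ‖p‖) ^ m := by
    rw [add_div]
    exact norm_add_le_of_le (hf.norm_le p) (hg.norm_le p)
  induction d generalizing m f g with
  | zero => exact ⟨hf.continuous.add hg.continuous, hbound hf hg⟩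
  | succ d ih =>
    refine ⟨hf.contDiff.add hg.contDiff, hbound hf hg, fun v hv => ?_⟩
    have hfderiv (p : E) :
        fderiv ℝ (fun p => f p + g p) p v = fderiv ℝ f p v + fderiv ℝ g p v := by
      rw [((hf.hasFDerivAt p).fun_add (hg.hasFDerivAt p)).fderiv, add_apply]
    simpa only [hfderiv] using ih (hf.fderiv_apply hv) (hg.fderiv_apply hv)

lemma const_mul (hf : IsSymbol C d m f) {a : ℂ} (ha : ‖a‖ ≤ 1) :
    IsSymbol C d m fun p => a * f p := by
  have hbound {d m : ℕ} {f : E → ℂ} (hf : IsSymbol C d m f) (p : E) :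
      ‖a * f p‖ ≤ C / (1 + ‖p‖) ^ m := by
    rw [norm_mul]
    exact (mul_le_of_le_one_left (norm_nonneg _) ha).trans (hf.norm_le p)
  induction d generalizing m f with
  | zero => exact ⟨hf.continuous.const_mul a, hbound hf⟩
  | succ d ih =>
    refine ⟨contDiff_const.mul hf.contDiff, hbound hf, fun v hv => ?_⟩
    have hfderiv (p : E) : fderiv ℝ (fun p => a * f p) p v = a * fderiv ℝ f p v := by
      rw [((hf.hasFDerivAt p).const_mul a).fderiv, smul_apply, smul_eq_mul]
    simpa only [hfderiv] using ih (hf.fderiv_apply hv)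

lemma comp_affine (hf : IsSymbol C d m f) {L : F →L[ℝ] E} (hL : ‖L‖ ≤ 1) (c : E)
    (hc : ∀ q, ‖q‖ ≤ ‖L q + c‖) : IsSymbol C d m fun q => f (L q + c) := by
  have hbound {d m : ℕ} {f : E → ℂ} (hf : IsSymbol C d m f) (q : F) :
      ‖f (L q + c)‖ ≤ C / (1 + ‖q‖) ^ m := by
    refine (hf.norm_le _).trans ?_
    gcongr
    exacts [hf.const_nonneg, hc q]
  induction d generalizing m f with
  | zero => exact ⟨hf.continuous.comp (by fun_prop), hbound hf⟩
  | succ d ih =>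
    refine ⟨hf.contDiff.comp (by fun_prop), hbound hf, fun v hv => ?_⟩
    have hLv : ‖L v‖ ≤ 1 := (L.le_of_opNorm_le_of_le hL hv).trans_eq (one_mul 1)
    have hfderiv (q : F) : fderiv ℝ (fun q => f (L q + c)) q v = fderiv ℝ f (L q + c) (L v) :=
      DFunLike.congr_fun
        ((hf.hasFDerivAt (L q + c)).comp q (L.hasFDerivAt.add_const c)).fderiv v
    simpa only [hfderiv] using ih (hf.fderiv_apply hLv)

lemma comp_isometry (hf : IsSymbol C d m f) (L : F →ₗᵢ[ℝ] E) :
    IsSymbol C d m fun q => f (L q) := by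
  simpa using hf.comp_affine L.norm_toContinuousLinearMap_le 0 (by simp)

end IsSymbol

end Symbol

@[fun_prop]
lemma continuous_fourierKernel (k : ℝ) : Continuous (fourierKernel k) := by
  unfold fourierKernel; fun_prop

@[simp]
lemma norm_fourierKernel (k x : ℝ) : ‖fourierKernel k x‖ = 1 := by
  simp [fourierKernel, Complex.norm_exp]

lemma hasDerivAt_fourierKernel (k x : ℝ) :
    HasDerivAt (fourierKernel k) (-(Complex.I * k) * fourierKernel k x) x := by
  have hexponent : HasDerivAt (fun x : ℝ => -(Complex.I * k * x)) (-(Complex.I * k)) x := by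
    simpa using ((Complex.ofRealCLM.hasDerivAt (x := x)).const_mul (Complex.I * (k : ℂ))).fun_neg
  exact hexponent.cexp.congr_deriv (mul_comm _ _)

lemma integrable_mul_fourierKernel {α : Type*} [MeasurableSpace α] {μ : Measure α} {g : α → ℂ}
    (hg : Integrable g μ) (k : ℝ) {u : α → ℝ} (hu : Measurable u) :
    Integrable (fun p => g p * fourierKernel k (u p)) μ :=
  hg.mul_bdd (c := 1) ((continuous_fourierKernel k).measurable.comp hu).aestronglyMeasurable <|
    .of_forall fun p => (norm_fourierKernel k (u p)).le

/-- The truncated Fourier transform `∫_{-r}^{r} u(x) e^{-ikx} dx`. -/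
noncomputable def truncTransform (k r : ℝ) (u : ℝ → ℂ) : ℂ :=
  ∫ x in (-r)..r, u x * fourierKernel k x

lemma truncTransform_eq_of_hasDerivAt {k : ℝ} (hk : k ≠ 0) (r : ℝ) {u u' : ℝ → ℂ}
    (hu : ∀ x, HasDerivAt u (u' x) x) (hu' : Continuous u') :
    truncTransform k r u = (Complex.I * k)⁻¹ *
      (truncTransform k r u' - (u r * fourierKernel k r - u (-r) * fourierKernel k (-r))) := by
  have hIk : Complex.I * (k : ℂ) ≠ 0 := mul_ne_zero Complex.I_ne_zero (by exact_mod_cast hk)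
  have hparts := intervalIntegral.integral_mul_deriv_eq_deriv_mul (a := -r) (b := r)
    (fun x _ => hu x) (fun x _ => hasDerivAt_fourierKernel k x)
    (hu'.intervalIntegrable _ _) (Continuous.intervalIntegrable (by fun_prop) _ _)
  simp only [mul_left_comm (u _), intervalIntegral.integral_const_mul] at hparts
  rw [eq_inv_mul_iff_mul_eq₀ hIk]
  simp only [truncTransform]
  linear_combination -hparts

lemma norm_inv_I_mul (k : ℝ) : ‖(Complex.I * (k : ℂ))⁻¹‖ = |k|⁻¹ := by simp

lemma truncTransform₂_eq_integral (g : ℝ → ℝ → ℂ) (k₁ k₂ r s : ℝ) :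
    (truncTransform k₂ s fun y => truncTransform k₁ r fun x => g x y) =
      ∫ y in (-s)..s, ∫ x in (-r)..r, g x y * fourierKernel k₁ x * fourierKernel k₂ y := by
  simp only [truncTransform, intervalIntegral.integral_mul_const]

lemma truncTransform₃_eq_integral (g : ℝ → ℝ → ℝ → ℂ) (k₁ k₂ k₃ r s t : ℝ) :
    (truncTransform k₃ t fun z => truncTransform k₂ s fun y => truncTransform k₁ r fun x =>
        g x y z) =
      ∫ z in (-t)..t, ∫ y in (-s)..s, ∫ x in (-r)..r,
        g x y z * fourierKernel k₁ x * fourierKernel k₂ y * fourierKernel k₃ z := by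
  simp only [truncTransform, intervalIntegral.integral_mul_const]

lemma truncTransform_swap {g : ℝ → ℝ → ℂ} (hg : Continuous fun p : ℝ × ℝ => g p.1 p.2)
    (k₁ k₂ r s : ℝ) :
    (truncTransform k₂ s fun y => truncTransform k₁ r fun x => g x y) =
      truncTransform k₁ r fun x => truncTransform k₂ s fun y => g x y := by
  have hcont : Continuous (Function.uncurry fun y x =>
      g x y * fourierKernel k₁ x * fourierKernel k₂ y) := by
    have := hg.comp continuous_swap
    unfold Function.uncurry
    fun_prop
  have hint : IntegrableOn (Function.uncurry fun y x =>
      g x y * fourierKernel k₁ x * fourierKernel k₂ y) (uIoc (-s) s ×ˢ uIoc (-r) r) :=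
    (hcont.continuousOn.integrableOn_compact (isCompact_uIcc.prod isCompact_uIcc)).mono_set
      (prod_mono uIoc_subset_uIcc uIoc_subset_uIcc)
  simp only [truncTransform₂_eq_integral]
  rw [intervalIntegral_intervalIntegral_swap hint]
  simp only [mul_right_comm]

lemma norm_integral_sub_intervalIntegral_le {g : ℝ → ℝ} {u : ℝ → ℂ} (hu : Continuous u)
    (hg : Integrable g) (hb : ∀ x, ‖u x‖ ≤ g x) {r : ℝ} (hr : 0 ≤ r) :
    ‖(∫ x, u x) - ∫ x in (-r)..r, u x‖ ≤ (∫ x, g x) - ∫ x in (-r)..r, g x := by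
  have hui : Integrable u := hg.mono' hu.aestronglyMeasurable (.of_forall hb)
  have hr' : -r ≤ r := neg_le_self hr
  rw [intervalIntegral.integral_of_le hr', intervalIntegral.integral_of_le hr',
    ← integral_add_compl measurableSet_Ioc hui, ← integral_add_compl measurableSet_Ioc hg,
    add_sub_cancel_left, add_sub_cancel_left]
  exact norm_integral_le_of_norm_le hg.integrableOn (.of_forall hb)

lemma norm_truncTransform_le_of_hasDerivAt {k r B : ℝ} (hk : k ≠ 0) (hr : 0 ≤ r)
    {u u' : ℝ → ℂ} {g : ℝ → ℝ} (hu : ∀ x, HasDerivAt u (u' x) x) (hu' : Continuous u')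
    (hB : ∀ x, ‖u x‖ ≤ B) (hg : Integrable g) (hg' : ∀ x, ‖u' x‖ ≤ g x) :
    ‖truncTransform k r u‖ ≤ |k|⁻¹ * ((∫ x, g x) + 2 * B) := by
  have hinterior : ‖truncTransform k r u'‖ ≤ ∫ x, g x := by
    refine (intervalIntegral.norm_integral_le_of_norm_le (neg_le_self hr)
      (.of_forall fun x _ => by simpa using hg' x) hg.intervalIntegrable).trans ?_
    rw [intervalIntegral.integral_of_le (neg_le_self hr)]
    exact setIntegral_le_integral hg (.of_forall fun x => (norm_nonneg _).trans (hg' x))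
  have hboundary : ‖u r * fourierKernel k r - u (-r) * fourierKernel k (-r)‖ ≤ 2 * B := by
    rw [two_mul]
    exact norm_sub_le_of_le (by simpa using hB r) (by simpa using hB (-r))
  rw [truncTransform_eq_of_hasDerivAt hk r hu hu', norm_mul, norm_inv_I_mul]
  gcongr
  exact norm_sub_le_of_le hinterior hboundary

lemma integrable_inv_one_add_div_sq {ρ : ℝ} (hρ : ρ ≠ 0) :
    Integrable fun x : ℝ => (1 + (x / ρ) ^ 2)⁻¹ :=
  integrable_inv_one_add_sq.comp_div hρ

lemma integral_inv_one_add_div_sq {ρ : ℝ} (hρ : 0 < ρ) :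
    ∫ x : ℝ, (1 + (x / ρ) ^ 2)⁻¹ = Real.pi * ρ := by
  rw [Measure.integral_comp_div (fun x : ℝ => (1 + x ^ 2)⁻¹) ρ, integral_univ_inv_one_add_sq,
    abs_of_pos hρ, smul_eq_mul, mul_comm]

lemma inv_one_add_norm_prod_pow_le {E : Type*} [SeminormedAddCommGroup E] (m : ℕ) (x : ℝ)
    (e : E) :
    ((1 + ‖(x, e)‖) ^ (m + 2))⁻¹ ≤
      2 / (1 + ‖e‖) ^ (m + 2) * (1 + (x / (1 + ‖e‖)) ^ 2)⁻¹ := by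
  have : 0 < 1 + ‖e‖ := by positivity
  have hx : |x| ≤ 1 + ‖(x, e)‖ := (norm_fst_le (x, e)).trans (le_add_of_nonneg_left zero_le_one)
  have he : 1 + ‖e‖ ≤ 1 + ‖(x, e)‖ := by gcongr; exact norm_snd_le (x, e)
  have hsq : (1 + ‖e‖) ^ 2 + x ^ 2 ≤ 2 * (1 + ‖(x, e)‖) ^ 2 := by
    rw [two_mul, ← sq_abs x]
    gcongr
  calc ((1 + ‖(x, e)‖) ^ (m + 2))⁻¹
      ≤ ((1 + ‖e‖) ^ m * (((1 + ‖e‖) ^ 2 + x ^ 2) / 2))⁻¹ := by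
        rw [pow_add]
        gcongr
        linarith
    _ = 2 / (1 + ‖e‖) ^ (m + 2) * (1 + (x / (1 + ‖e‖)) ^ 2)⁻¹ := by
        field_simp
        ring

/-- A bound, on symbols of order at most `-1` with constant `1`, for the truncated transform,
uniformly in the radius. -/
noncomputable def transformConst (k : ℝ) : ℝ := |k|⁻¹ * (2 * Real.pi + 2)

/-- A bound, on symbols of order `-1` with constant `1`, for the distance between the transform
truncated at radius `r` and its limit. -/
noncomputable def transformTail (k r : ℝ) : ℝ :=
  |k|⁻¹ * (Real.pi - 2 * Real.arctan r + 2 / (1 + r))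

lemma tendsto_transformTail (k : ℝ) : Tendsto (transformTail k) atTop (𝓝 0) := by
  have harctan : Tendsto (fun r => Real.pi - 2 * Real.arctan r) atTop (𝓝 0) := by
    simpa [mul_div_cancel₀] using
      ((tendsto_nhds_of_tendsto_nhdsWithin Real.tendsto_arctan_atTop).const_mul 2).const_sub Real.pi
  have hboundary : Tendsto (fun r : ℝ => 2 / (1 + r)) atTop (𝓝 0) :=
    tendsto_const_nhds.div_atTop (tendsto_atTop_add_const_left _ _ tendsto_id)
  unfold transformTail
  simpa using (harctan.add hboundary).const_mul |k|⁻¹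

lemma continuous_truncTransform {Y : Type*} [TopologicalSpace Y] {f : ℝ × Y → ℂ}
    (hf : Continuous f) (k r : ℝ) : Continuous fun e => truncTransform k r fun x => f (x, e) := by
  unfold truncTransform
  fun_prop

section ParametricSymbol

variable {E : Type*} [NormedAddCommGroup E] [NormedSpace ℝ E] {C k r : ℝ} {d m : ℕ}
  {f : ℝ × E → ℂ}

namespace IsSymbol

lemma hasDerivAt_prodMk (hf : IsSymbol C (d + 1) m f) (e : E) (x : ℝ) :
    HasDerivAt (fun x => f (x, e)) (fderiv ℝ f (x, e) (1, 0)) x :=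
  (hf.hasFDerivAt (x, e)).comp_hasDerivAt x ((hasDerivAt_id x).prodMk (hasDerivAt_const x e))

lemma fderiv_fst (hf : IsSymbol C (d + 1) m f) :
    IsSymbol C d (m + 1) fun p => fderiv ℝ f p (1, 0) :=
  hf.fderiv_apply (by simp [Prod.norm_def])

/-- Transforming the variable `x` does not worsen the order of decay in `e`: the power of
`1 + ‖e‖` lost by integrating over `x` is the one gained by integrating by parts. -/
lemma norm_truncTransform_le (hf : IsSymbol C 1 (m + 1) f) (hk : k ≠ 0) (hr : 0 ≤ r) (e : E) :
    ‖truncTransform k r fun x => f (x, e)‖ ≤ transformConst k * C / (1 + ‖e‖) ^ (m + 1) := by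
  have hρ : 0 < 1 + ‖e‖ := by positivity
  have hC := hf.const_nonneg
  have hf' := hf.fderiv_fst
  have hboundary (x : ℝ) : ‖f (x, e)‖ ≤ C / (1 + ‖e‖) ^ (m + 1) := by
    refine (hf.norm_le _).trans ?_
    gcongr
    exact norm_snd_le (x, e)
  have hderiv (x : ℝ) : ‖fderiv ℝ f (x, e) (1, 0)‖ ≤
      C * (2 / (1 + ‖e‖) ^ (m + 2)) * (1 + (x / (1 + ‖e‖)) ^ 2)⁻¹ := by
    refine (hf'.norm_le _).trans ?_
    rw [div_eq_mul_inv, mul_assoc]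
    exact mul_le_mul_of_nonneg_left (inv_one_add_norm_prod_pow_le m x e) hC
  refine (norm_truncTransform_le_of_hasDerivAt hk hr (hf.hasDerivAt_prodMk e)
    (hf'.continuous.comp (by fun_prop)) hboundary
    ((integrable_inv_one_add_div_sq hρ.ne').const_mul _) hderiv).trans_eq ?_
  rw [integral_const_mul, integral_inv_one_add_div_sq hρ, transformConst]
  field_simp
  ring

end IsSymbol

lemma hasFDerivAt_truncTransform (hf : ContDiff ℝ 1 f) (hC : ∀ p, ‖fderiv ℝ f p‖ ≤ C)
    (k r : ℝ) (e : E) :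
    HasFDerivAt (fun e => truncTransform k r fun x => f (x, e))
      (∫ x in (-r)..r, fourierKernel k x • (fderiv ℝ f (x, e)).comp (.inr ℝ ℝ E)) e := by
  have hf₀ := hf.continuous
  have := hf.continuous_fderiv one_ne_zero
  refine intervalIntegral.hasFDerivAt_integral_of_dominated_of_fderiv_le (μ := volume)
    (F := fun e x => f (x, e) * fourierKernel k x)
    (F' := fun e x => fourierKernel k x • (fderiv ℝ f (x, e)).comp (.inr ℝ ℝ E))
    (bound := fun _ => C) univ_mem
    (.of_forall fun e => Continuous.aestronglyMeasurable (by fun_prop))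
    (Continuous.intervalIntegrable (by fun_prop) _ _)
    (Continuous.aestronglyMeasurable (by fun_prop))
    (.of_forall fun x _ e _ => ?_) intervalIntegrable_const
    (.of_forall fun x _ e _ => ?_)
  · rw [norm_smul, norm_fourierKernel, one_mul]
    exact ((ContinuousLinearMap.opNorm_comp_le _ _).trans <| mul_le_of_le_one_right (norm_nonneg _)
      (ContinuousLinearMap.norm_inr_le_one ℝ ℝ E)).trans (hC _)
  · exact ((hf.differentiable one_ne_zero (x, e)).hasFDerivAt.comp e
      (hasFDerivAt_prodMk_right x e)).mul_const (fourierKernel k x)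

lemma contDiff_truncTransform (hf : ContDiff ℝ 1 f) (hC : ∀ p, ‖fderiv ℝ f p‖ ≤ C) (k r : ℝ) :
    ContDiff ℝ 1 fun e => truncTransform k r fun x => f (x, e) := by
  have := hf.continuous_fderiv one_ne_zero
  exact contDiff_one_iff_hasFDerivAt.2 ⟨_, by fun_prop, hasFDerivAt_truncTransform hf hC k r⟩

lemma fderiv_truncTransform_apply (hf : ContDiff ℝ 1 f) (hC : ∀ p, ‖fderiv ℝ f p‖ ≤ C)
    (k r : ℝ) (e v : E) :
    fderiv ℝ (fun e => truncTransform k r fun x => f (x, e)) e v =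
      truncTransform k r fun x => fderiv ℝ f (x, e) (0, v) := by
  have := hf.continuous_fderiv one_ne_zero
  rw [(hasFDerivAt_truncTransform hf hC k r e).fderiv,
    ContinuousLinearMap.intervalIntegral_apply (Continuous.intervalIntegrable (by fun_prop) _ _)]
  simp [truncTransform, mul_comm]

protected lemma IsSymbol.truncTransform (hf : IsSymbol C (d + 1) (m + 1) f) (hk : k ≠ 0)
    (hr : 0 ≤ r) :
    IsSymbol (transformConst k * C) d (m + 1) fun e => truncTransform k r fun x => f (x, e) := by
  induction d generalizing m f with
  | zero =>
    exact ⟨continuous_truncTransform hf.continuous k r, hf.norm_truncTransform_le hk hr⟩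
  | succ d ih =>
    refine ⟨contDiff_truncTransform hf.contDiff hf.norm_fderiv_le k r,
      (hf.mono le_rfl (by omega) le_rfl).norm_truncTransform_le hk hr, fun v hv => ?_⟩
    simp only [fderiv_truncTransform_apply hf.contDiff hf.norm_fderiv_le]
    exact ih (hf.fderiv_apply (by simpa [Prod.norm_def] using hv))

end ParametricSymbol

lemma integrable_of_norm_le_div_one_add_norm_pow {E : Type*} [NormedAddCommGroup E]
    [NormedSpace ℝ E] [FiniteDimensional ℝ E] [MeasurableSpace E] [BorelSpace E] {μ : Measure E}
    [μ.IsAddHaarMeasure] {g : E → ℂ} (hg : AEStronglyMeasurable g μ) {C : ℝ} {n : ℕ}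
    (hn : Module.finrank ℝ E < n) (hC : ∀ e, ‖g e‖ ≤ C / (1 + ‖e‖) ^ n) : Integrable g μ := by
  refine ((integrable_one_add_norm (μ := μ) (r := n) (by exact_mod_cast hn)).const_mul C).mono' hg
    (.of_forall fun e => (hC e).trans_eq ?_)
  rw [Real.rpow_neg (by positivity), Real.rpow_natCast, div_eq_mul_inv]

/-- The conditionally convergent Fourier integral `lim_{r → ∞} ∫_{-r}^{r} u(x) e^{-ikx} dx`; a junk
value where this limit does not exist. -/
noncomputable def improperTransform (k : ℝ) (u : ℝ → ℂ) : ℂ :=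
  limUnder atTop fun r => truncTransform k r u

lemma tendsto_truncTransform_of_integrable {u : ℝ → ℂ} (hu : Integrable u) (k : ℝ) :
    Tendsto (fun r => truncTransform k r u) atTop (𝓝 (∫ x, u x * fourierKernel k x)) :=
  intervalIntegral_tendsto_integral (integrable_mul_fourierKernel hu k measurable_id)
    tendsto_neg_atTop_atBot tendsto_id

namespace IsSymbol

section Line

variable {C k r : ℝ} {d m : ℕ} {u : ℝ → ℂ}

lemma hasDerivAt (hu : IsSymbol C (d + 1) m u) (x : ℝ) : HasDerivAt u (deriv u x) x :=
  (hu.hasFDerivAt x).differentiableAt.hasDerivAt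

protected lemma deriv (hu : IsSymbol C (d + 1) m u) : IsSymbol C d (m + 1) (deriv u) :=
  hu.fderiv_apply (v := 1) (by simp)

lemma integrable_deriv (hu : IsSymbol C (d + 1) 1 u) : Integrable (deriv u) :=
  integrable_of_norm_le_div_one_add_norm_pow hu.deriv.continuous.aestronglyMeasurable (n := 2)
    (by simp) hu.deriv.norm_le

lemma norm_truncTransform_sub_le (hu : IsSymbol C 1 1 u) (hk : k ≠ 0) (hr : 0 ≤ r) :
    ‖truncTransform k r u - (Complex.I * k)⁻¹ * ∫ x, deriv u x * fourierKernel k x‖ ≤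
      transformTail k r * C := by
  have hderiv (x : ℝ) : ‖deriv u x * fourierKernel k x‖ ≤ C * (1 + x ^ 2)⁻¹ := by
    rw [norm_mul, norm_fourierKernel, mul_one, ← div_eq_mul_inv]
    refine (hu.deriv.norm_le x).trans (div_le_div_of_nonneg_left hu.const_nonneg (by positivity) ?_)
    rw [Real.norm_eq_abs, ← sq_abs x, one_add_one_eq_two]
    nlinarith [abs_nonneg x]
  have hinterior := norm_integral_sub_intervalIntegral_le
    (u := fun x => deriv u x * fourierKernel k x)
    (hu.deriv.continuous.mul (by fun_prop)) (integrable_inv_one_add_sq.const_mul C) hderiv hr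
  rw [integral_const_mul, intervalIntegral.integral_const_mul, integral_univ_inv_one_add_sq,
    integral_inv_one_add_sq, Real.arctan_neg, norm_sub_rev] at hinterior
  have hboundary : ‖u r * fourierKernel k r - u (-r) * fourierKernel k (-r)‖ ≤
      C / (1 + r) + C / (1 + r) := by
    refine norm_sub_le_of_le ?_ ?_
    · simpa [abs_of_nonneg hr] using hu.norm_le r
    · simpa [abs_of_nonneg hr] using hu.norm_le (-r)
  rw [truncTransform_eq_of_hasDerivAt hk r hu.hasDerivAt hu.deriv.continuous, ← mul_sub, norm_mul,
    norm_inv_I_mul, transformTail, mul_assoc, sub_right_comm]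
  gcongr
  refine (norm_sub_le_of_le hinterior hboundary).trans_eq ?_
  ring

lemma tendsto_truncTransform_integral_deriv (hu : IsSymbol C 1 1 u) (hk : k ≠ 0) :
    Tendsto (fun r => truncTransform k r u) atTop
      (𝓝 ((Complex.I * k)⁻¹ * ∫ x, deriv u x * fourierKernel k x)) := by
  rw [tendsto_iff_norm_sub_tendsto_zero]
  refine squeeze_zero' (.of_forall fun r => norm_nonneg _)
    ((eventually_ge_atTop 0).mono fun r hr => hu.norm_truncTransform_sub_le hk hr) ?_
  simpa using (tendsto_transformTail k).mul_const C

lemma improperTransform_eq (hu : IsSymbol C 1 1 u) (hk : k ≠ 0) :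
    improperTransform k u = (Complex.I * k)⁻¹ * improperTransform k (deriv u) := by
  rw [improperTransform, (hu.tendsto_truncTransform_integral_deriv hk).limUnder_eq,
    improperTransform, (tendsto_truncTransform_of_integrable hu.integrable_deriv k).limUnder_eq]

lemma tendsto_truncTransform (hu : IsSymbol C 1 1 u) (hk : k ≠ 0) :
    Tendsto (fun r => truncTransform k r u) atTop (𝓝 (improperTransform k u)) :=
  tendsto_nhds_limUnder ⟨_, hu.tendsto_truncTransform_integral_deriv hk⟩

lemma norm_truncTransform_sub_improperTransform_le (hu : IsSymbol C 1 1 u) (hk : k ≠ 0)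
    (hr : 0 ≤ r) :
    ‖truncTransform k r u - improperTransform k u‖ ≤ transformTail k r * C := by
  rw [improperTransform, (hu.tendsto_truncTransform_integral_deriv hk).limUnder_eq]
  exact hu.norm_truncTransform_sub_le hk hr

end Line

end IsSymbol

lemma tendsto_truncTransform_of_tendsto {ι : Type*} {l : Filter ι} [l.IsCountablyGenerated]
    {C k : ℝ} (hk : k ≠ 0) {φ : ι → ℝ → ℂ} {ψ : ℝ → ℂ} (hφ : ∀ᶠ i in l, IsSymbol C 1 1 (φ i))
    (hlim : ∀ x, Tendsto (fun i => φ i x) l (𝓝 (ψ x))) (hψ : Integrable ψ) :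
    Tendsto (fun q : ℝ × ι => truncTransform k q.1 (φ q.2)) (atTop ×ˢ l)
      (𝓝 (∫ x, ψ x * fourierKernel k x)) := by
  have hdist : Tendsto (fun q : ℝ × ι =>
      dist (improperTransform k (φ q.2)) (truncTransform k q.1 (φ q.2))) (atTop ×ˢ l) (𝓝 0) := by
    refine squeeze_zero' (.of_forall fun q => dist_nonneg)
      (((eventually_ge_atTop 0).prod_mk hφ).mono fun q hq => ?_)
      (g := fun q => transformTail k q.1 * C) ?_
    · rw [dist_comm, dist_eq_norm]
      exact hq.2.norm_truncTransform_sub_improperTransform_le hk hq.1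
    · simpa using ((tendsto_transformTail k).comp tendsto_fst).mul_const C
  have hunif : TendstoUniformlyOnFilter (fun r i => truncTransform k r (φ i))
      (fun i => improperTransform k (φ i)) atTop l :=
    tendstoUniformlyOnFilter_iff_tendsto.2 (tendsto_uniformity_iff_dist_tendsto_zero.2 hdist)
  have hfixed (r : ℝ) :
      Tendsto (fun i => truncTransform k r (φ i)) l (𝓝 (truncTransform k r ψ)) :=
    intervalIntegral.tendsto_integral_filter_of_dominated_convergence (fun _ => C)
      (hφ.mono fun i hi => (hi.continuous.mul (by fun_prop)).aestronglyMeasurable)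
      (hφ.mono fun i hi => .of_forall fun x _ => by simpa using hi.norm_le_const x)
      intervalIntegrable_const (.of_forall fun x _ => (hlim x).mul_const _)
  have hiterated : Tendsto (fun i => improperTransform k (φ i)) l
      (𝓝 (∫ x, ψ x * fourierKernel k x)) :=
    hunif.tendsto_of_eventually_tendsto (.of_forall hfixed)
      (tendsto_truncTransform_of_integrable hψ k)
  exact (hiterated.comp tendsto_snd).congr_dist hdist

section Improper

variable {E : Type*} [NormedAddCommGroup E] [NormedSpace ℝ E] {C k : ℝ} {d m n : ℕ} {f : ℝ × E → ℂ}

namespace IsSymbol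

lemma comp_prodMk_right (hf : IsSymbol C d m f) (e : E) : IsSymbol C d m fun x => f (x, e) := by
  simpa using hf.comp_affine (L := .inl ℝ ℝ E) (ContinuousLinearMap.norm_inl_le_one ℝ ℝ E) (0, e)
    fun x => by simp

lemma comp_prodMk_left (hf : IsSymbol C d m f) (x : ℝ) : IsSymbol C d m fun e => f (x, e) := by
  simpa using hf.comp_affine (L := .inr ℝ ℝ E) (ContinuousLinearMap.norm_inr_le_one ℝ ℝ E) (x, 0)
    fun e => by simp

lemma tendsto_truncTransform_prodMk (hf : IsSymbol C (d + 1) (m + 1) f) (hk : k ≠ 0) (e : E) :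
    Tendsto (fun r => truncTransform k r fun x => f (x, e)) atTop
      (𝓝 (improperTransform k fun x => f (x, e))) :=
  ((hf.comp_prodMk_right e).mono le_rfl (by omega) (by omega)).tendsto_truncTransform hk

/-- Each derivative beyond the first gains a power of `1 + ‖e‖`, again by parts. -/
lemma norm_improperTransform_le (hf : IsSymbol C (n + 1) (m + 1) f) (hk : k ≠ 0) (e : E) :
    ‖improperTransform k fun x => f (x, e)‖ ≤
      |k|⁻¹ ^ n * (transformConst k * C) / (1 + ‖e‖) ^ (m + 1 + n) := by
  induction n generalizing m f with
  | zero =>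
    rw [pow_zero, one_mul]
    exact le_of_tendsto (hf.tendsto_truncTransform_prodMk hk e).norm <|
      (eventually_ge_atTop 0).mono fun r hr => hf.norm_truncTransform_le hk hr e
  | succ n ih =>
    have hf' := hf.fderiv_fst
    have hline : IsSymbol C 1 1 fun x => f (x, e) :=
      (hf.comp_prodMk_right e).mono le_rfl (by omega) (by omega)
    rw [hline.improperTransform_eq hk, norm_mul, norm_inv_I_mul,
      funext fun x => (hf.hasDerivAt_prodMk e x).deriv, pow_succ', mul_assoc, mul_div_assoc]
    gcongr
    refine (ih hf').trans_eq ?_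
    congr 2
    omega

lemma integrable_improperTransform [FiniteDimensional ℝ E] [MeasurableSpace E] [BorelSpace E]
    {μ : Measure E} [μ.IsAddHaarMeasure] (hf : IsSymbol C (n + 1) (m + 1) f)
    (hn : Module.finrank ℝ E < m + 1 + n) (hk : k ≠ 0) :
    Integrable (fun e => improperTransform k fun x => f (x, e)) μ := by
  have hmeas : AEStronglyMeasurable (fun e => improperTransform k fun x => f (x, e)) μ :=
    aestronglyMeasurable_of_tendsto_ae atTop
      (fun r => (continuous_truncTransform hf.continuous k r).aestronglyMeasurable)
      (.of_forall fun e => hf.tendsto_truncTransform_prodMk hk e)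
  exact integrable_of_norm_le_div_one_add_norm_pow hmeas hn (hf.norm_improperTransform_le hk)

end IsSymbol

end Improper

namespace IsSymbol

section Swap

variable {X Y Z : Type*} [NormedAddCommGroup X] [NormedSpace ℝ X] [NormedAddCommGroup Y]
  [NormedSpace ℝ Y] [NormedAddCommGroup Z] [NormedSpace ℝ Z] {C : ℝ} {d m : ℕ} {f : X × Y × Z → ℂ}

lemma swap_xy (hf : IsSymbol C d m f) :
    IsSymbol C d m fun p : Y × X × Z => f (p.2.1, p.1, p.2.2) :=
  hf.comp_isometry (F := Y × X × Z)
    { toFun p := (p.2.1, p.1, p.2.2)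
      map_add' _ _ := rfl
      map_smul' _ _ := rfl
      norm_map' _ := max_left_comm .. }

lemma swap_yz (hf : IsSymbol C d m f) :
    IsSymbol C d m fun p : X × Z × Y => f (p.1, p.2.2, p.2.1) :=
  hf.comp_isometry (F := X × Z × Y)
    { toFun p := (p.1, p.2.2, p.2.1)
      map_add' _ _ := rfl
      map_smul' _ _ := rfl
      norm_map' _ := congrArg _ (max_comm ..) }

end Swap

section Iterated

variable {C k₁ k₂ k₃ : ℝ}

lemma tendsto_truncTransform₂ {f : ℝ × ℝ → ℂ} (hf : IsSymbol C 2 1 f) (h₁ : k₁ ≠ 0) (h₂ : k₂ ≠ 0) :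
    Tendsto (fun q : ℝ × ℝ =>
        truncTransform k₂ q.1 fun y => truncTransform k₁ q.2 fun x => f (x, y))
      (atTop ×ˢ atTop)
      (𝓝 (∫ y, improperTransform k₁ (fun x => f (x, y)) * fourierKernel k₂ y)) := by
  have hφ : ∀ᶠ r in atTop, IsSymbol (transformConst k₁ * C) 1 1 fun y =>
      truncTransform k₁ r fun x => f (x, y) :=
    (eventually_ge_atTop 0).mono fun _ hr => hf.truncTransform h₁ hr
  exact (tendsto_truncTransform_of_tendsto h₂ hφ
    (hf.tendsto_truncTransform_prodMk h₁)
    (hf.integrable_improperTransform (m := 0) (by simp) h₁) :)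

variable {f : ℝ × ℝ × ℝ → ℂ}

lemma tendsto_truncTransform₂_prodMk (hf : IsSymbol C 3 1 f) (h₁ : k₁ ≠ 0) (h₂ : k₂ ≠ 0) (z : ℝ) :
    Tendsto (fun q : ℝ × ℝ =>
        truncTransform k₂ q.1 fun y => truncTransform k₁ q.2 fun x => f (x, y, z))
      (atTop ×ˢ atTop)
      (𝓝 (∫ y, improperTransform k₁ (fun x => f (x, y, z)) * fourierKernel k₂ y)) :=
  ((hf.swap_yz.swap_xy.comp_prodMk_left z).mono le_rfl (by omega) le_rfl).tendsto_truncTransform₂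
    h₁ h₂

lemma integrable_improperTransform_mul (hf : IsSymbol C 3 1 f) (h₁ : k₁ ≠ 0) (k₂ k₃ : ℝ) :
    Integrable fun p : ℝ × ℝ => improperTransform k₁ (fun x => f (x, p)) *
      fourierKernel k₂ p.1 * fourierKernel k₃ p.2 :=
  integrable_mul_fourierKernel (integrable_mul_fourierKernel
    (hf.integrable_improperTransform (by simp) h₁) k₂ measurable_fst) k₃ measurable_snd

lemma integrable_integral_fst (hf : IsSymbol C 3 1 f) (h₁ : k₁ ≠ 0) (k₂ : ℝ) :
    Integrable fun z => ∫ y, improperTransform k₁ (fun x => f (x, y, z)) * fourierKernel k₂ y :=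
  (integrable_mul_fourierKernel (hf.integrable_improperTransform (by simp) h₁) k₂
    measurable_fst).integral_prod_right

lemma tendsto_truncTransform₃ (hf : IsSymbol C 3 1 f) (h₁ : k₁ ≠ 0) (h₂ : k₂ ≠ 0) (h₃ : k₃ ≠ 0) :
    Tendsto (fun q : ℝ × ℝ × ℝ => truncTransform k₃ q.1 fun z => truncTransform k₂ q.2.1 fun y =>
        truncTransform k₁ q.2.2 fun x => f (x, y, z))
      (atTop ×ˢ atTop ×ˢ atTop)
      (𝓝 (∫ z, (∫ y, improperTransform k₁ (fun x => f (x, y, z)) * fourierKernel k₂ y) *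
        fourierKernel k₃ z)) := by
  have hφ : ∀ᶠ q : ℝ × ℝ in atTop ×ˢ atTop,
      IsSymbol (transformConst k₂ * (transformConst k₁ * C)) 1 1 fun z =>
        truncTransform k₂ q.1 fun y => truncTransform k₁ q.2 fun x => f (x, y, z) :=
    ((eventually_ge_atTop 0).prod_mk (eventually_ge_atTop 0)).mono fun _ hq =>
      (hf.truncTransform h₁ hq.2).truncTransform h₂ hq.1
  exact (tendsto_truncTransform_of_tendsto h₃ hφ (hf.tendsto_truncTransform₂_prodMk h₁ h₂)
    (hf.integrable_integral_fst h₁ k₂) :)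

lemma integral_swap_xy (hf : IsSymbol C 3 1 f) (h₁ : k₁ ≠ 0) (h₂ : k₂ ≠ 0) (h₃ : k₃ ≠ 0) :
    ∫ z, (∫ x, improperTransform k₂ (fun y => f (x, y, z)) * fourierKernel k₁ x) *
        fourierKernel k₃ z =
      ∫ z, (∫ y, improperTransform k₁ (fun x => f (x, y, z)) * fourierKernel k₂ y) *
        fourierKernel k₃ z := by
  have hswap : Tendsto (fun q : ℝ × ℝ × ℝ => (q.1, q.2.2, q.2.1)) (atTop ×ˢ atTop ×ˢ atTop)
      (atTop ×ˢ atTop ×ˢ atTop) :=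
    tendsto_fst.prodMk ((tendsto_snd.comp tendsto_snd).prodMk (tendsto_fst.comp tendsto_snd))
  refine tendsto_nhds_unique ((hf.swap_xy.tendsto_truncTransform₃ h₂ h₁ h₃).comp hswap)
    ((hf.tendsto_truncTransform₃ h₁ h₂ h₃).congr fun q => ?_)
  refine congrArg (truncTransform k₃ q.1) (funext fun z => ?_)
  have := hf.continuous
  exact truncTransform_swap (by fun_prop) k₁ k₂ q.2.2 q.2.1

lemma integral_swap_yz (hf : IsSymbol C 3 1 f) (h₁ : k₁ ≠ 0) (k₂ k₃ : ℝ) :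
    ∫ y, (∫ z, improperTransform k₁ (fun x => f (x, y, z)) * fourierKernel k₃ z) *
        fourierKernel k₂ y =
      ∫ z, (∫ y, improperTransform k₁ (fun x => f (x, y, z)) * fourierKernel k₂ y) *
        fourierKernel k₃ z := by
  simp only [← integral_mul_const, mul_right_comm _ (fourierKernel k₃ _)]
  exact integral_integral_swap (hf.integrable_improperTransform_mul h₁ k₂ k₃)

end Iterated

end IsSymbol

lemma exists_norm_le_div_one_add_norm_pow {E F : Type*} [SeminormedAddCommGroup E] [ProperSpace E]
    [SeminormedAddCommGroup F] {g : E → F} (hg : Continuous g) {C R : ℝ} {n : ℕ}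
    (hC : ∀ p, R < ‖p‖ → ‖g p‖ ≤ C / ‖p‖ ^ n) :
    ∃ C', ∀ p, ‖g p‖ ≤ C' / (1 + ‖p‖) ^ n := by
  obtain ⟨K, hK⟩ := (isCompact_closedBall (0 : E) (max R 1)).exists_bound_of_continuousOn
    (f := fun p => (1 + ‖p‖) ^ n * ‖g p‖) (by fun_prop)
  refine ⟨max K (2 ^ n * C), fun p => ?_⟩
  rw [le_div_iff₀' (by positivity)]
  rcases le_or_gt ‖p‖ (max R 1) with hp | hp
  · exact (Real.le_norm_self _).trans ((hK p (mem_closedBall_zero_iff.2 hp)).trans (le_max_left ..))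
  · obtain ⟨hRp, h_one⟩ := max_lt_iff.1 hp
    calc (1 + ‖p‖) ^ n * ‖g p‖ ≤ (2 * ‖p‖) ^ n * (C / ‖p‖ ^ n) := by
          gcongr
          · linarith
          · exact hC p hRp
      _ = 2 ^ n * C := by
          rw [mul_pow, mul_assoc, mul_div_cancel₀ _ (by positivity)]
      _ ≤ max K (2 ^ n * C) := le_max_right ..

lemma norm_le_sqrt_sq_add_sq_add_sq (x y z : ℝ) : ‖(x, y, z)‖ ≤ √(x ^ 2 + y ^ 2 + z ^ 2) := by
  have hx := sq_nonneg x
  have hy := sq_nonneg y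
  have hz := sq_nonneg z
  exact max_le (Real.abs_le_sqrt (by linarith))
    (max_le (Real.abs_le_sqrt (by linarith)) (Real.abs_le_sqrt (by linarith)))

lemma IsOfDecrease₃.exists_norm_le {n : ℕ} {W : Set (ℝ × ℝ × ℝ)} {g : ℝ × ℝ × ℝ → ℝ}
    (hg : IsOfDecrease₃ n W fun x y z => g (x, y, z)) (hW : Bornology.IsBounded W)
    (hcont : Continuous g) : ∃ C, ∀ p, ‖g p‖ ≤ C / (1 + ‖p‖) ^ n := by
  obtain ⟨C, hC, hbound⟩ := hg
  obtain ⟨R, hR⟩ := hW.subset_closedBall 0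
  refine exists_norm_le_div_one_add_norm_pow hcont (C := C) (R := max R 1) fun ⟨x, y, z⟩ hp => ?_
  obtain ⟨hRp, h_one⟩ := max_lt_iff.1 hp
  have hsqrt := norm_le_sqrt_sq_add_sq_add_sq x y z
  have hnotMem : (x, y, z) ∉ W := fun hmem => hRp.not_ge (mem_closedBall_zero_iff.1 (hR hmem))
  exact (hbound x y z hnotMem (h_one.trans_le hsqrt)).trans (by gcongr)

section DirectionalDerivative

variable {E : Type*} [NormedAddCommGroup E] [NormedSpace ℝ E] {g : E → ℝ}

/-- The derivative of `g` in the direction `v`, as an operator that can be iterated. -/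
noncomputable def dirDeriv (v : E) (g : E → ℝ) : E → ℝ := fun p => fderiv ℝ g p v

lemma contDiff_dirDeriv (hg : ContDiff ℝ ∞ g) (v : E) : ContDiff ℝ ∞ (dirDeriv v g) :=
  (hg.fderiv_right (m := ∞) (by simp)).clm_apply contDiff_const

lemma contDiff_iterate_dirDeriv (hg : ContDiff ℝ ∞ g) (v : E) (n : ℕ) :
    ContDiff ℝ ∞ ((dirDeriv v)^[n] g) := by
  induction n with
  | zero => exact hg
  | succ n ih => rw [Function.iterate_succ_apply']; exact contDiff_dirDeriv ih v

lemma dirDeriv_comm (hg : ContDiff ℝ ∞ g) (v w : E) :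
    dirDeriv v (dirDeriv w g) = dirDeriv w (dirDeriv v g) := by
  have hfderiv : Differentiable ℝ (fderiv ℝ g) :=
    (hg.fderiv_right (m := 1) (by norm_cast)).differentiable one_ne_zero
  have hsecond (v w p : E) : dirDeriv v (dirDeriv w g) p = fderiv ℝ (fderiv ℝ g) p v w := by
    change fderiv ℝ (fun p => fderiv ℝ g p w) p v = _
    simp [((hfderiv p).hasFDerivAt.clm_apply (hasFDerivAt_const w p)).fderiv]
  ext p
  rw [hsecond, hsecond]
  exact second_derivative_symmetric (fun q => (hg.differentiable (by simp) q).hasFDerivAt)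
    (hfderiv p).hasFDerivAt v w

lemma dirDeriv_iterate_comm (hg : ContDiff ℝ ∞ g) (v w : E) (n : ℕ) :
    dirDeriv v ((dirDeriv w)^[n] g) = (dirDeriv w)^[n] (dirDeriv v g) := by
  induction n with
  | zero => rfl
  | succ n ih =>
    rw [Function.iterate_succ_apply', Function.iterate_succ_apply',
      dirDeriv_comm (contDiff_iterate_dirDeriv hg w n), ih]

lemma iteratedDeriv_comp_eq_iterate_dirDeriv (hg : ContDiff ℝ ∞ g) {γ : ℝ → E} {v : E}
    (hγ : ∀ t, HasDerivAt γ v t) (n : ℕ) (t : ℝ) :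
    iteratedDeriv n (fun t => g (γ t)) t = (dirDeriv v)^[n] g (γ t) := by
  induction n generalizing g with
  | zero => simp
  | succ n ih =>
    have hderiv : deriv (fun t => g (γ t)) = fun t => dirDeriv v g (γ t) := funext fun t =>
      ((hg.differentiable (by simp) (γ t)).hasFDerivAt.comp_hasDerivAt t (hγ t)).deriv
    rw [iteratedDeriv_succ', hderiv, ih (contDiff_dirDeriv hg v), Function.iterate_succ_apply]

end DirectionalDerivative

section MixedDerivative

variable {g : ℝ × ℝ × ℝ → ℝ}

lemma fderiv_apply_eq_dirDeriv (g : ℝ × ℝ × ℝ → ℝ) (p v : ℝ × ℝ × ℝ) :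
    fderiv ℝ g p v = v.1 * dirDeriv (1, 0, 0) g p + v.2.1 * dirDeriv (0, 1, 0) g p +
      v.2.2 * dirDeriv (0, 0, 1) g p := by
  have hv : v = v.1 • (1, 0, 0) + v.2.1 • (0, 1, 0) + v.2.2 • (0, 0, 1) := by ext <;> simp
  conv_lhs => rw [hv]
  simp only [map_add, map_smul, smul_eq_mul, dirDeriv]

/-- The partial derivative `∂^{i+j+k} g / ∂x^i ∂y^j ∂z^k`, as `partialDeriv₃` but with the
derivatives taken on `ℝ³` rather than along lines, so that they commute. -/
noncomputable def mixedDeriv (i j k : ℕ) (g : ℝ × ℝ × ℝ → ℝ) : ℝ × ℝ × ℝ → ℝ :=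
  (dirDeriv (1, 0, 0))^[i] ((dirDeriv (0, 1, 0))^[j] ((dirDeriv (0, 0, 1))^[k] g))

lemma contDiff_mixedDeriv (hg : ContDiff ℝ ∞ g) (i j k : ℕ) : ContDiff ℝ ∞ (mixedDeriv i j k g) :=
  contDiff_iterate_dirDeriv (contDiff_iterate_dirDeriv (contDiff_iterate_dirDeriv hg _ k) _ j) _ i

lemma partialDeriv₃_eq_mixedDeriv (hg : ContDiff ℝ ∞ g) (i j k : ℕ) (x y z : ℝ) :
    partialDeriv₃ i j k (fun x y z => g (x, y, z)) x y z = mixedDeriv i j k g (x, y, z) := by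
  have hz := contDiff_iterate_dirDeriv hg (0, 0, 1) k
  have hyz := contDiff_iterate_dirDeriv hz (0, 1, 0) j
  have hlineX (t : ℝ) : HasDerivAt (fun x => (x, y, z)) (1, 0, 0) t :=
    (hasDerivAt_id t).prodMk (hasDerivAt_const t (y, z))
  have hlineY (x t : ℝ) : HasDerivAt (fun y => (x, y, z)) (0, 1, 0) t :=
    (hasDerivAt_const t x).prodMk ((hasDerivAt_id t).prodMk (hasDerivAt_const t z))
  have hlineZ (x y t : ℝ) : HasDerivAt (fun z => (x, y, z)) (0, 0, 1) t :=
    (hasDerivAt_const t x).prodMk ((hasDerivAt_const t y).prodMk (hasDerivAt_id t))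
  simp only [partialDeriv₃, mixedDeriv, iteratedDeriv_comp_eq_iterate_dirDeriv hg (hlineZ _ _),
    iteratedDeriv_comp_eq_iterate_dirDeriv hz (hlineY _),
    iteratedDeriv_comp_eq_iterate_dirDeriv hyz hlineX]

lemma dirDeriv_x_mixedDeriv (i j k : ℕ) (g : ℝ × ℝ × ℝ → ℝ) :
    dirDeriv (1, 0, 0) (mixedDeriv i j k g) = mixedDeriv (i + 1) j k g := by
  rw [mixedDeriv, mixedDeriv, Function.iterate_succ_apply']

lemma dirDeriv_y_mixedDeriv (hg : ContDiff ℝ ∞ g) (i j k : ℕ) :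
    dirDeriv (0, 1, 0) (mixedDeriv i j k g) = mixedDeriv i (j + 1) k g := by
  have hz := contDiff_iterate_dirDeriv hg (0, 0, 1) k
  rw [mixedDeriv, mixedDeriv, dirDeriv_iterate_comm (contDiff_iterate_dirDeriv hz _ j),
    Function.iterate_succ_apply']

lemma dirDeriv_z_mixedDeriv (hg : ContDiff ℝ ∞ g) (i j k : ℕ) :
    dirDeriv (0, 0, 1) (mixedDeriv i j k g) = mixedDeriv i j (k + 1) g := by
  have hz := contDiff_iterate_dirDeriv hg (0, 0, 1) k
  rw [mixedDeriv, mixedDeriv, dirDeriv_iterate_comm (contDiff_iterate_dirDeriv hz _ j),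
    dirDeriv_iterate_comm hz, Function.iterate_succ_apply']

lemma fderiv_ofReal_mixedDeriv_apply (hg : ContDiff ℝ ∞ g) (i j k : ℕ) (p v : ℝ × ℝ × ℝ) :
    fderiv ℝ (fun p => (mixedDeriv i j k g p : ℂ)) p v = v.1 * mixedDeriv (i + 1) j k g p +
      v.2.1 * mixedDeriv i (j + 1) k g p + v.2.2 * mixedDeriv i j (k + 1) g p := by
  have hderiv : HasFDerivAt (fun p => (mixedDeriv i j k g p : ℂ)) _ p :=
    Complex.ofRealCLM.hasFDerivAt.comp p
      ((contDiff_mixedDeriv hg i j k).differentiable (by simp) p).hasFDerivAt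
  simp [hderiv.fderiv, fderiv_apply_eq_dirDeriv, dirDeriv_x_mixedDeriv, dirDeriv_y_mixedDeriv hg,
    dirDeriv_z_mixedDeriv hg]

lemma exists_isSymbol_mixedDeriv (hg : ContDiff ℝ ∞ g)
    (hbound : ∀ i j k, ∃ C, ∀ p, ‖mixedDeriv i j k g p‖ ≤ C / (1 + ‖p‖) ^ (i + j + k + 1))
    (d i j k : ℕ) : ∃ C, IsSymbol C d (i + j + k + 1) fun p => (mixedDeriv i j k g p : ℂ) := by
  have hboundC (i j k : ℕ) :
      ∃ C, ∀ p, ‖(mixedDeriv i j k g p : ℂ)‖ ≤ C / (1 + ‖p‖) ^ (i + j + k + 1) := by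
    simpa only [Complex.norm_real] using hbound i j k
  induction d generalizing i j k with
  | zero =>
    obtain ⟨C, hC⟩ := hboundC i j k
    exact ⟨C, Complex.continuous_ofReal.comp (contDiff_mixedDeriv hg i j k).continuous, hC⟩
  | succ d ih =>
    obtain ⟨C, hC⟩ := hboundC i j k
    obtain ⟨Cx, hx⟩ := ih (i + 1) j k
    obtain ⟨Cy, hy⟩ := ih i (j + 1) k
    obtain ⟨Cz, hz⟩ := ih i j (k + 1)
    refine ⟨max C (Cx + Cy + Cz), Complex.ofRealCLM.contDiff.comp
      ((contDiff_mixedDeriv hg i j k).of_le (by simp)), fun p => (hC p).trans (by gcongr; simp),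
      fun v hv => ?_⟩
    simp only [fderiv_ofReal_mixedDeriv_apply hg]
    have hvx : ‖(v.1 : ℂ)‖ ≤ 1 := (Complex.norm_real _).trans_le ((norm_fst_le v).trans hv)
    have hvyz : ‖v.2‖ ≤ 1 := (norm_snd_le v).trans hv
    have hvy : ‖(v.2.1 : ℂ)‖ ≤ 1 := (Complex.norm_real _).trans_le ((norm_fst_le v.2).trans hvyz)
    have hvz : ‖(v.2.2 : ℂ)‖ ≤ 1 := (Complex.norm_real _).trans_le ((norm_snd_le v.2).trans hvyz)
    exact ((((hx.mono le_rfl le_rfl (by omega)).const_mul hvx).add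
      ((hy.mono le_rfl le_rfl (by omega)).const_mul hvy)).add
      ((hz.mono le_rfl le_rfl (by omega)).const_mul hvz)).mono (le_max_right ..) le_rfl le_rfl

lemma IsPreNormal₃.exists_isSymbol {f : ℝ → ℝ → ℝ → ℝ} (hf : IsPreNormal₃ ∅ f) (d : ℕ) :
    ∃ C, IsSymbol C d 1 fun p : ℝ × ℝ × ℝ => (f p.1 p.2.1 p.2.2 : ℂ) := by
  have hg : ContDiff ℝ ∞ fun p : ℝ × ℝ × ℝ => f p.1 p.2.1 p.2.2 := by
    simpa [contDiffOn_univ] using hf.smooth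
  have hdecrease (i j k : ℕ) : IsOfDecrease₃ (i + j + k + 1) ∅ (partialDeriv₃ i j k f) := by
    rcases Nat.eq_zero_or_pos (i + j + k) with hzero | hpos
    · obtain ⟨⟨rfl, rfl⟩, rfl⟩ : (i = 0 ∧ j = 0) ∧ k = 0 := by omega
      exact hf.decrease
    · exact hf.decrease_partialDeriv i j k hpos
  refine exists_isSymbol_mixedDeriv hg (fun i j k => ?_) d 0 0 0
  refine IsOfDecrease₃.exists_norm_le ?_ hf.isBounded (contDiff_mixedDeriv hg i j k).continuous
  simpa only [← partialDeriv₃_eq_mixedDeriv hg] using hdecrease i j k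

end MixedDerivative

theorem mainTheorem9_general {K : ℝ} {f : ℝ × ℝ × ℝ → ℂ} (hf : IsSymbol K 3 1 f) :
    ∃ A B C F G H : ℝ → ℝ → ℝ → ℂ,
      (∀ k₁ : ℝ, k₁ ≠ 0 → ∀ y z : ℝ,
        Tendsto (fun r : ℝ => ∫ x in (-r)..r, f (x, y, z) * fourierKernel k₁ x)
          atTop (𝓝 (A k₁ y z))) ∧
      (∀ k₂ : ℝ, k₂ ≠ 0 → ∀ x z : ℝ,
        Tendsto (fun r : ℝ => ∫ y in (-r)..r, f (x, y, z) * fourierKernel k₂ y)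
          atTop (𝓝 (B x k₂ z))) ∧
      (∀ k₃ : ℝ, k₃ ≠ 0 → ∀ x y : ℝ,
        Tendsto (fun r : ℝ => ∫ z in (-r)..r, f (x, y, z) * fourierKernel k₃ z)
          atTop (𝓝 (C x y k₃))) ∧
      (∀ k₁ k₂ : ℝ, k₁ ≠ 0 → k₂ ≠ 0 → ∀ z : ℝ,
        Tendsto (fun q : ℝ × ℝ => ∫ y in (-q.1)..q.1, ∫ x in (-q.2)..q.2,
            f (x, y, z) * fourierKernel k₁ x * fourierKernel k₂ y)
          (atTop ×ˢ atTop) (𝓝 (F k₁ k₂ z))) ∧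
      (∀ k₁ k₃ : ℝ, k₁ ≠ 0 → k₃ ≠ 0 → ∀ y : ℝ,
        Tendsto (fun q : ℝ × ℝ => ∫ z in (-q.1)..q.1, ∫ x in (-q.2)..q.2,
            f (x, y, z) * fourierKernel k₁ x * fourierKernel k₃ z)
          (atTop ×ˢ atTop) (𝓝 (G k₁ y k₃))) ∧
      (∀ k₂ k₃ : ℝ, k₂ ≠ 0 → k₃ ≠ 0 → ∀ x : ℝ,
        Tendsto (fun q : ℝ × ℝ => ∫ z in (-q.1)..q.1, ∫ y in (-q.2)..q.2,
            f (x, y, z) * fourierKernel k₂ y * fourierKernel k₃ z)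
          (atTop ×ˢ atTop) (𝓝 (H x k₂ k₃))) ∧
      ∀ k₁ k₂ k₃ : ℝ, k₁ ≠ 0 → k₂ ≠ 0 → k₃ ≠ 0 →
        Integrable (fun p : ℝ × ℝ => A k₁ p.1 p.2 * fourierKernel k₂ p.1 * fourierKernel k₃ p.2) ∧
        Integrable (fun p : ℝ × ℝ => B p.1 k₂ p.2 * fourierKernel k₁ p.1 * fourierKernel k₃ p.2) ∧
        Integrable (fun p : ℝ × ℝ => C p.1 p.2 k₃ * fourierKernel k₁ p.1 * fourierKernel k₂ p.2) ∧
        Integrable (fun z : ℝ => F k₁ k₂ z * fourierKernel k₃ z) ∧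
        Integrable (fun y : ℝ => G k₁ y k₃ * fourierKernel k₂ y) ∧
        Integrable (fun x : ℝ => H x k₂ k₃ * fourierKernel k₁ x) ∧
        ∃ L : ℂ,
          (∫ z : ℝ, ∫ y : ℝ, A k₁ y z * fourierKernel k₂ y * fourierKernel k₃ z) = L ∧
          (∫ z : ℝ, ∫ x : ℝ, B x k₂ z * fourierKernel k₁ x * fourierKernel k₃ z) = L ∧
          (∫ y : ℝ, ∫ x : ℝ, C x y k₃ * fourierKernel k₁ x * fourierKernel k₂ y) = L ∧
          (∫ z : ℝ, F k₁ k₂ z * fourierKernel k₃ z) = L ∧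
          (∫ y : ℝ, G k₁ y k₃ * fourierKernel k₂ y) = L ∧
          (∫ x : ℝ, H x k₂ k₃ * fourierKernel k₁ x) = L ∧
          Tendsto (fun q : ℝ × ℝ × ℝ =>
              ∫ z in (-q.1)..q.1, ∫ y in (-q.2.1)..q.2.1, ∫ x in (-q.2.2)..q.2.2,
                f (x, y, z) * fourierKernel k₁ x * fourierKernel k₂ y * fourierKernel k₃ z)
            (atTop ×ˢ atTop ×ˢ atTop) (𝓝 L) := by
  have hyx := hf.swap_xy
  have hxzy := hf.swap_yz
  have hyzx := hf.swap_xy.swap_yz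
  have hzxy := hf.swap_yz.swap_xy
  refine ⟨fun k₁ y z => improperTransform k₁ fun x => f (x, y, z),
    fun x k₂ z => improperTransform k₂ fun y => f (x, y, z),
    fun x y k₃ => improperTransform k₃ fun z => f (x, y, z),
    fun k₁ k₂ z => ∫ y, improperTransform k₁ (fun x => f (x, y, z)) * fourierKernel k₂ y,
    fun k₁ y k₃ => ∫ z, improperTransform k₁ (fun x => f (x, y, z)) * fourierKernel k₃ z,
    fun x k₂ k₃ => ∫ z, improperTransform k₂ (fun y => f (x, y, z)) * fourierKernel k₃ z,
    fun k₁ h₁ y z => hf.tendsto_truncTransform_prodMk h₁ (y, z),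
    fun k₂ h₂ x z => hyx.tendsto_truncTransform_prodMk h₂ (x, z),
    fun k₃ h₃ x y => hzxy.tendsto_truncTransform_prodMk h₃ (x, y),
    fun k₁ k₂ h₁ h₂ z => ?_, fun k₁ k₃ h₁ h₃ y => ?_, fun k₂ k₃ h₂ h₃ x => ?_,
    fun k₁ k₂ k₃ h₁ h₂ h₃ => ⟨hf.integrable_improperTransform_mul h₁ k₂ k₃,
      hyx.integrable_improperTransform_mul h₂ k₁ k₃,
      hzxy.integrable_improperTransform_mul h₃ k₁ k₂,
      integrable_mul_fourierKernel (hf.integrable_integral_fst h₁ k₂) k₃ measurable_id,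
      integrable_mul_fourierKernel (hxzy.integrable_integral_fst h₁ k₃) k₂ measurable_id,
      integrable_mul_fourierKernel (hyzx.integrable_integral_fst h₂ k₃) k₁ measurable_id,
      ∫ z, (∫ y, improperTransform k₁ (fun x => f (x, y, z)) * fourierKernel k₂ y) *
        fourierKernel k₃ z, ?_, ?_, ?_, rfl, hf.integral_swap_yz h₁ k₂ k₃,
      (hyx.integral_swap_yz h₂ k₁ k₃).trans (hf.integral_swap_xy h₁ h₂ h₃), ?_⟩⟩
  · simpa only [truncTransform₂_eq_integral] using hf.tendsto_truncTransform₂_prodMk h₁ h₂ z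
  · simpa only [truncTransform₂_eq_integral] using hxzy.tendsto_truncTransform₂_prodMk h₁ h₃ y
  · simpa only [truncTransform₂_eq_integral] using hyzx.tendsto_truncTransform₂_prodMk h₂ h₃ x
  · simp only [integral_mul_const]
  · simpa only [integral_mul_const] using hf.integral_swap_xy h₁ h₂ h₃
  · simpa only [integral_mul_const] using
      (hxzy.integral_swap_xy h₁ h₃ h₂).trans (hf.integral_swap_yz h₁ k₂ k₃)
  · simpa only [truncTransform₃_eq_integral] using hf.tendsto_truncTransform₃ h₁ h₂ h₃

theorem mainTheorem9 (f : ℝ → ℝ → ℝ → ℝ)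
    (hf : IsQuasiNormal₃ ∅ f ∨ IsQuasiSplitNormal₃ ∅ f) :
    ∃ A B C F G H : ℝ → ℝ → ℝ → ℂ,
      -- the limits defining the partial transforms exist
      (∀ k₁ : ℝ, k₁ ≠ 0 → ∀ y z : ℝ,
        Tendsto (fun r : ℝ => ∫ x in (-r)..r, (f x y z : ℂ) * fourierKernel k₁ x)
          atTop (𝓝 (A k₁ y z))) ∧
      (∀ k₂ : ℝ, k₂ ≠ 0 → ∀ x z : ℝ,
        Tendsto (fun r : ℝ => ∫ y in (-r)..r, (f x y z : ℂ) * fourierKernel k₂ y)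
          atTop (𝓝 (B x k₂ z))) ∧
      (∀ k₃ : ℝ, k₃ ≠ 0 → ∀ x y : ℝ,
        Tendsto (fun r : ℝ => ∫ z in (-r)..r, (f x y z : ℂ) * fourierKernel k₃ z)
          atTop (𝓝 (C x y k₃))) ∧
      (∀ k₁ k₂ : ℝ, k₁ ≠ 0 → k₂ ≠ 0 → ∀ z : ℝ,
        Tendsto (fun q : ℝ × ℝ => ∫ y in (-q.1)..q.1, ∫ x in (-q.2)..q.2,
            (f x y z : ℂ) * fourierKernel k₁ x * fourierKernel k₂ y)
          (atTop ×ˢ atTop) (𝓝 (F k₁ k₂ z))) ∧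
      (∀ k₁ k₃ : ℝ, k₁ ≠ 0 → k₃ ≠ 0 → ∀ y : ℝ,
        Tendsto (fun q : ℝ × ℝ => ∫ z in (-q.1)..q.1, ∫ x in (-q.2)..q.2,
            (f x y z : ℂ) * fourierKernel k₁ x * fourierKernel k₃ z)
          (atTop ×ˢ atTop) (𝓝 (G k₁ y k₃))) ∧
      (∀ k₂ k₃ : ℝ, k₂ ≠ 0 → k₃ ≠ 0 → ∀ x : ℝ,
        Tendsto (fun q : ℝ × ℝ => ∫ z in (-q.1)..q.1, ∫ y in (-q.2)..q.2,
            (f x y z : ℂ) * fourierKernel k₂ y * fourierKernel k₃ z)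
          (atTop ×ˢ atTop) (𝓝 (H x k₂ k₃))) ∧
      ∀ k₁ k₂ k₃ : ℝ, k₁ ≠ 0 → k₂ ≠ 0 → k₃ ≠ 0 →
        -- the integrals defining the full transforms converge absolutely
        Integrable (fun p : ℝ × ℝ => A k₁ p.1 p.2 * fourierKernel k₂ p.1 * fourierKernel k₃ p.2) ∧
        Integrable (fun p : ℝ × ℝ => B p.1 k₂ p.2 * fourierKernel k₁ p.1 * fourierKernel k₃ p.2) ∧
        Integrable (fun p : ℝ × ℝ => C p.1 p.2 k₃ * fourierKernel k₁ p.1 * fourierKernel k₂ p.2) ∧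
        Integrable (fun z : ℝ => F k₁ k₂ z * fourierKernel k₃ z) ∧
        Integrable (fun y : ℝ => G k₁ y k₃ * fourierKernel k₂ y) ∧
        Integrable (fun x : ℝ => H x k₂ k₃ * fourierKernel k₁ x) ∧
        -- they all agree, and they equal the limit of the integrals over boxes
        ∃ L : ℂ,
          (∫ z : ℝ, ∫ y : ℝ, A k₁ y z * fourierKernel k₂ y * fourierKernel k₃ z) = L ∧
          (∫ z : ℝ, ∫ x : ℝ, B x k₂ z * fourierKernel k₁ x * fourierKernel k₃ z) = L ∧
          (∫ y : ℝ, ∫ x : ℝ, C x y k₃ * fourierKernel k₁ x * fourierKernel k₂ y) = L ∧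
          (∫ z : ℝ, F k₁ k₂ z * fourierKernel k₃ z) = L ∧
          (∫ y : ℝ, G k₁ y k₃ * fourierKernel k₂ y) = L ∧
          (∫ x : ℝ, H x k₂ k₃ * fourierKernel k₁ x) = L ∧
          Tendsto (fun q : ℝ × ℝ × ℝ =>
              ∫ z in (-q.1)..q.1, ∫ y in (-q.2.1)..q.2.1, ∫ x in (-q.2.2)..q.2.2,
                (f x y z : ℂ) * fourierKernel k₁ x * fourierKernel k₂ y * fourierKernel k₃ z)
            (atTop ×ˢ atTop ×ˢ atTop) (𝓝 L) := by
  obtain ⟨K, hK⟩ := (hf.elim (·.preNormal) (·.preNormal)).exists_isSymbol 3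
  exact mainTheorem9_general hK
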